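/- Strings are over $\{0,1\}$. A (possibly partial) binary function $\sigma:\Sigma^*\times\Sigma^*\to\Sigma^*$ is *honest* if there is a polynomial $p$ such that every $z\in\mathrm{range}(\sigma)$ has some $(x,y)\in\mathrm{domain}(\sigma)$ with $\sigma(x,y)=z$ and $|x|+|y|\le p(|z|)$. It is *FP-invertible* if there is a total polynomial-time computable $g:\Sigma^*\to\Sigma^*\times\Sigma^*$ such that $\sigma(g(z))=z$ for every $z\in\mathrm{range}(\sigma)$. It is a *one-way function* if it is honest, polynomial-time computable, and not FP-invertible. It is *weakly associative* if $\sigma(x,\sigma(y,z))=\sigma(\sigma(x,y),z)$ for all strings $x,y,z$ such that $(x,y)$, $(y,z)$, $(x,\sigma(y,z))$ and $(\sigma(x,y),z)$ all lie in $\mathrm{domain}(\sigma)$; it is *associative* if, for all strings $x,y,z$, the two sides $\sigma(x,\sigma(y,z))$ and $\sigma(\sigma(x,y),z)$ are either both undefined, or both defined and equal. An *A$^{w}$OWF* is a weakly associative one-way function. $\mathrm{NP}$ is the class of languages accepted by nondeterministic polynomial-time Turing machines, and $\mathrm{UP}$ the class of those accepted by such machines with at most one accepting path on every input. Assume $\mathrm{UP}\neq\mathrm{NP}$.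 Then there is an A$^{w}$OWF $\tilde\sigma$ whose domain is in $\mathrm{P}$ and for which there is a string $\tilde a$ with $(\tilde a,\tilde a)\notin\mathrm{domain}(\tilde\sigma)$, such that Rabi and Sherman's construction of a total function from $\tilde\sigma$ fails: for every string $\tilde a$ with $(\tilde a,\tilde a)\notin\mathrm{domain}(\tilde\sigma)$, the total function $$\tilde\tau(a,b)=\begin{cases}\tilde\sigma(a,b)&\text{if }(a,b)\in\mathrm{domain}(\tilde\sigma),\\ \tilde a&\text{otherwise}\end{cases}$$ is not associative and not weakly associative. -/

import Mathlib

namespace OneWay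

/-- Strings over the alphabet `{0, 1}`. -/
abbrev Str : Type := List Bool

/-! ### Machines

Multi-tape Turing machines in the stack presentation of Mathlib's `Turing.TM2` model. There are `n`
input stacks, `m` output stacks and finitely many work stacks, a finite set of labels and a finite
internal state. -/

/-- A Turing machine with `n` inputs and `m` outputs. At every step it executes the statement that
one of the programs `prog c`, `c : C`, attaches to the current label. `C = Unit` gives deterministic
machines, `C = Bool` nondeterministic machines (two transition functions). -/
structure Machine (C : Type) (n m : ℕ) where
  /-- index type of the work stacks -/
  W : Type
  [decW : DecidableEq W]
  [finW : Fintype W]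
  /-- labels -/
  L : Type
  [finL : Fintype L]
  /-- internal states -/
  S : Type
  [finS : Fintype S]
  /-- label at which the machine starts -/
  start : L
  /-- internal state in which the machine starts -/
  init : S
  /-- the internal states that accept, when the machine halts in them -/
  acc : S → Bool
  /-- the programs -/
  prog : C → L → Turing.TM2.Stmt (fun _ : Fin n ⊕ Fin m ⊕ W => Bool) L S

namespace Machine

variable {C : Type} {n m : ℕ} (M : Machine C n m)

/-- The stacks: inputs, outputs, work stacks. -/
abbrev Stk : Type := Fin n ⊕ Fin m ⊕ M.W

instance : DecidableEq M.W := M.decW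

/-- Configurations; the label `none` means that the machine has halted. -/
abbrev Cfg : Type := Turing.TM2.Cfg (fun _ : M.Stk => Bool) M.L M.S

/-- The initial configuration: the input strings (first letter on top) are on the input stacks, all
other stacks are empty. -/
def initial (x : Fin n → Str) : M.Cfg where
  l := some M.start
  var := M.init
  stk := Sum.elim x fun _ => []

/-- One step of computation. -/
def Next (c c' : M.Cfg) : Prop :=
  ∃ b : C, Turing.TM2.step (M.prog b) c = some c'

/-- `p` is a (possibly unfinished) computation path of `M` on input `x`: a sequence of
configurations that starts with the initial one, each being a successor of the previous one. -/
def IsPath (x : Fin n → Str) (p : List M.Cfg) : Prop :=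
  p.head? = some (M.initial x) ∧ p.IsChain M.Next

/-- `p` is a computation path on `x` that ends in `c`, where `M` has halted in an accepting state. -/
def IsAcceptingPathTo (x : Fin n → Str) (p : List M.Cfg) (c : M.Cfg) : Prop :=
  M.IsPath x p ∧ p.getLast? = some c ∧ c.l = none ∧ M.acc c.var = true

/-- `p` is an accepting computation path of `M` on input `x`. -/
def IsAcceptingPath (x : Fin n → Str) (p : List M.Cfg) : Prop :=
  ∃ c, M.IsAcceptingPathTo x p c

/-- `M` accepts `x` if it has an accepting path on `x`. -/
def Accepts (x : Fin n → Str) : Prop := ∃ p, M.IsAcceptingPath x p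

/-- Some accepting path of `M` on `x` ends with the strings `y` on the output stacks. -/
def Outputs (x : Fin n → Str) (y : Fin m → Str) : Prop :=
  ∃ p c, M.IsAcceptingPathTo x p c ∧ ∀ j, c.stk (Sum.inr (Sum.inl j)) = y j

/-- `M` is a polynomial-time machine: on every input, all its computation paths have a number of
steps bounded by a polynomial in the total input length. -/
def PolyTime : Prop :=
  ∃ q : Polynomial ℕ, ∀ (x : Fin n → Str) (p : List M.Cfg), M.IsPath x p →
    p.length ≤ q.eval (∑ i, (x i).length) + 1

end Machine

/-! ### Complexity classes -/

/-- Membership in `P`, for sets of `n`-tuples of strings. -/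
def InP {n : ℕ} (A : Set (Fin n → Str)) : Prop :=
  ∃ M : Machine Unit n 0, M.PolyTime ∧ ∀ x, x ∈ A ↔ M.Accepts x

/-- `NP`: the languages accepted by nondeterministic polynomial-time Turing machines. -/
def NP : Set (Language Bool) :=
  {A | ∃ M : Machine Bool 1 0, M.PolyTime ∧ ∀ x, x ∈ A ↔ M.Accepts ![x]}

/-- `UP`: the languages accepted by nondeterministic polynomial-time Turing machines that have on
every input at most one accepting path. -/
def UP : Set (Language Bool) :=
  {A | ∃ M : Machine Bool 1 0, M.PolyTime ∧ (∀ x, x ∈ A ↔ M.Accepts ![x]) ∧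
    ∀ x, {p | M.IsAcceptingPath ![x] p}.Subsingleton}

/-- A partial function of `n` strings with values in `m`-tuples of strings (`none` is "undefined")
is computable in polynomial time: a deterministic polynomial-time machine outputs the value where
the function is defined, and does not accept elsewhere. -/
def PolyTimeComputable {n m : ℕ} (f : (Fin n → Str) → Option (Fin m → Str)) : Prop :=
  ∃ M : Machine Unit n m, M.PolyTime ∧ ∀ x y, f x = some y ↔ M.Outputs x y

/-! ### Binary functions -/

/-- Partial binary functions on strings; `none` is "undefined". -/
abbrev BinFun : Type := Str → Str → Option Str

namespace BinFun

/-- The domain of `σ`, as a set of pairs of strings. -/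
def domain (σ : BinFun) : Set (Fin 2 → Str) := {v | ∃ z, σ (v 0) (v 1) = some z}

/-- The range of `σ`. -/
def range (σ : BinFun) : Set Str := {z | ∃ x y, σ x y = some z}

def Honest (σ : BinFun) : Prop :=
  ∃ p : Polynomial ℕ, ∀ z ∈ σ.range, ∃ x y, σ x y = some z ∧ x.length + y.length ≤ p.eval z.length

def FPInvertible (σ : BinFun) : Prop :=
  ∃ g : Str → Str × Str,
    PolyTimeComputable (fun v : Fin 1 → Str => some ![(g (v 0)).1, (g (v 0)).2]) ∧
    ∀ z ∈ σ.range, σ (g z).1 (g z).2 = some z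

def IsOneWay (σ : BinFun) : Prop :=
  σ.Honest ∧
  PolyTimeComputable (fun v : Fin 2 → Str => (σ (v 0) (v 1)).map fun z => ![z]) ∧
  ¬ σ.FPInvertible

/-- `x ∘ (y ∘ z) = (x ∘ y) ∘ z` whenever all four applications involved are defined. -/
def WeaklyAssociative (σ : BinFun) : Prop :=
  ∀ x y z xy yz l r : Str, σ x y = some xy → σ y z = some yz →
    σ x yz = some l → σ xy z = some r → l = r

/-- The extension of `σ` to strings together with an undefined element `none`. -/
def hat (σ : BinFun) : Option Str → Option Str → Option Str
  | some a, some b => σ a b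
  | _, _ => none

/-- Associativity with respect to complete equality. -/
def Associative (σ : BinFun) : Prop :=
  ∀ x y z : Str, σ.hat (σ.hat (some x) (some y)) (some z) = σ.hat (some x) (σ.hat (some y) (some z))

/-- Weakly associative one-way functions. -/
def IsAwOWF (σ : BinFun) : Prop := σ.WeaklyAssociative ∧ σ.IsOneWay

/-- The total function that agrees with `σ` on its domain and has the value `a₀` elsewhere. -/
def totalExtension (σ : BinFun) (a₀ : Str) : BinFun := fun a b => some ((σ a b).getD a₀)

end BinFun

end OneWay

namespace OneWay

open Turing TM2 Function

/-! ### Runs of deterministic transition systems -/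

/-! Since UP is contained in NP, the assumption gives a language A in NP but not in UP; let M be a
nondeterministic polynomial-time machine for A. The function is `witnessFun M`: it sends (1w, 0x) to
0 followed by x reversed when the choice sequence w makes M accept x, and it sends (ε, ε) and all
pairs (1s, 1t) to ε.

It is one-way because an inverter applied to 0 followed by x reversed must return a witness for x if
there is one. Checking the returned candidate is deterministic and polynomial, so A would lie in P,
hence in UP (`mem_UP_of_fpInvertible`).

Values are ε or start with 0, while defined first arguments are ε or start with 1, and a second
argument ε forces the first to be ε. So all four applications in the associativity law are defined
only when all three arguments are ε, and weak associativity is immediate. The pairs (1s, 1t) serve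
only to break the total extension: they leave just strings a starting with 0 as possible fill-in
values, and then (1 ∘ 1) ∘ ε = ε whereas 1 ∘ (1 ∘ ε) = 1 ∘ a starts with 0.

Most of the work is machine building. Programs are assembled from fragments with exact step counts
(`Frag.Run`), giving one fragment that evaluates the function and decides its domain
(`Frag.run_eval`), and one that decides A from an inverter (`Frag.run_decider`). -/

/-- `StepsIn f n a b`: the partial function `f`, iterated `n` times, leads from `a` to `b`. -/
inductive StepsIn {α : Type} (f : α → Option α) : ℕ → α → α → Prop
  | refl (a : α) : StepsIn f 0 a a
  | head {a b c : α} {n : ℕ} : f a = some b → StepsIn f n b c → StepsIn f (n + 1) a c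

theorem StepsIn.trans {α : Type} {f : α → Option α} {m n : ℕ} {a b c : α}
    (h : StepsIn f m a b) (h' : StepsIn f n b c) : StepsIn f (m + n) a c := by
  induction h with
  | refl => simpa using h'
  | @head _ _ _ k h₁ _ ih =>
    rw [Nat.add_right_comm]
    exact .head h₁ (ih h')

/-- A chain that follows a partial function which halts after `n` steps has at most `n + 1`
elements, and if it ends in a terminal element then it ends where the function halts. -/
theorem StepsIn.chain {α : Type} {f : α → Option α} {n : ℕ} {a b : α}
    (h : StepsIn f n a b) (hb : f b = none) {p : List α} (hp : p.head? = some a)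
    (hc : p.IsChain fun x y => f x = some y) :
    p.length ≤ n + 1 ∧ ∀ c, p.getLast? = some c → f c = none → c = b := by
  induction h generalizing p with
  | refl a =>
    rcases p with _ | ⟨x, _ | ⟨y, p⟩⟩
    · simp at hp
    · simp at hp
      subst hp
      simp
    · simp at hp hc
      subst hp
      rw [hb] at hc
      simp at hc
  | @head a a' _ n h₁ _ ih =>
    rcases p with _ | ⟨x, _ | ⟨y, p⟩⟩
    · simp at hp
    · simp at hp
      subst hp
      simp only [List.length_singleton, List.getLast?_singleton, Option.some.injEq]
      refine ⟨by omega, ?_⟩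
      rintro c rfl h
      rw [h] at h₁
      simp at h₁
    · simp at hp
      subst hp
      rw [List.isChain_cons_cons] at hc
      have hy : y = a' := by
        have := hc.1
        rw [h₁] at this
        simpa using this.symm
      subst hy
      obtain ⟨h₂, h₃⟩ := ih hb (p := y :: p) rfl hc.2
      refine ⟨by simpa using h₂, fun c hc' => h₃ c ?_⟩
      rwa [List.getLast?_cons_cons] at hc'

theorem StepsIn.of_chain {α : Type} {f : α → Option α} {a b : α} {p : List α}
    (hp : p.head? = some a) (hb : p.getLast? = some b)
    (hc : p.IsChain fun x y => f x = some y) : StepsIn f (p.length - 1) a b := by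
  induction p generalizing a with
  | nil => simp at hp
  | cons x p ih =>
    rcases p with _ | ⟨y, p⟩
    · simp at hp hb
      subst hp hb
      exact .refl _
    · simp at hp
      subst hp
      rw [List.isChain_cons_cons] at hc
      rw [List.getLast?_cons_cons] at hb
      exact .head hc.1 (ih rfl hb hc.2)

theorem StepsIn.exists_chain {α : Type} {f : α → Option α} {n : ℕ} {a b : α}
    (h : StepsIn f n a b) : ∃ p : List α, p.length = n + 1 ∧ p.head? = some a ∧
      p.getLast? = some b ∧ p.IsChain fun x y => f x = some y := by
  induction h with
  | refl a => exact ⟨[a], by simp⟩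
  | head h₁ _ ih =>
    obtain ⟨p, h₂, h₃, h₄, h₅⟩ := ih
    rcases p with _ | ⟨y, p⟩
    · simp at h₂
    · simp at h₃
      subst h₃
      refine ⟨_ :: y :: p, by simpa using h₂, rfl, ?_, ?_⟩
      · rwa [List.getLast?_cons_cons]
      · exact List.isChain_cons_cons.2 ⟨h₁, h₅⟩

/-- Two chains that follow a partial function from the same start to terminal elements agree. -/
theorem eq_of_chain {α : Type} {f : α → Option α} {a : α} {p p' : List α}
    (hp : p.head? = some a) (hp' : p'.head? = some a)
    (hc : p.IsChain fun x y => f x = some y) (hc' : p'.IsChain fun x y => f x = some y)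
    (hl : ∀ c, p.getLast? = some c → f c = none)
    (hl' : ∀ c, p'.getLast? = some c → f c = none) : p = p' := by
  induction p generalizing a p' with
  | nil => simp at hp
  | cons x p ih =>
    rcases p' with _ | ⟨x', p'⟩
    · simp at hp'
    simp at hp hp'
    subst hp hp'
    rcases p with _ | ⟨y, p⟩ <;> rcases p' with _ | ⟨y', p'⟩
    · rfl
    · have := hl x' (by simp)
      rw [List.isChain_cons_cons] at hc'
      simp [hc'.1] at this
    · have := hl' x' (by simp)
      rw [List.isChain_cons_cons] at hc
      simp [hc.1] at this
    · rw [List.isChain_cons_cons] at hc hc'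
      have hy : y' = y := by
        have := hc.1.symm.trans hc'.1
        simpa using this.symm
      subst hy
      rw [ih (p' := y' :: p') rfl rfl hc.2 hc'.2]
      · intro c h
        exact hl c (by rwa [List.getLast?_cons_cons])
      · intro c h
        exact hl' c (by rwa [List.getLast?_cons_cons])

theorem step_eq_none {K L S : Type} [DecidableEq K] {M : L → Stmt (fun _ : K => Bool) L S}
    {c : Cfg (fun _ : K => Bool) L S} : TM2.step M c = none ↔ c.l = none := by
  rcases c with ⟨_ | l, v, T⟩ <;> simp

/-! ### Nondeterministic machines: choice sequences as witnesses -/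

namespace Machine

variable {n m : ℕ}

theorem next_unit (M : Machine Unit n m) :
    M.Next = fun c c' => TM2.step (M.prog ()) c = some c' := by
  ext c c'
  exact ⟨fun ⟨_, h⟩ => h, fun h => ⟨(), h⟩⟩

/-- The configuration that a nondeterministic machine reaches from `c` with the choices `w`;
`none` if it halts before the choices are used up. -/
def run (M : Machine Bool n m) : M.Cfg → Str → Option M.Cfg
  | c, [] => some c
  | c, b :: w => (TM2.step (M.prog b) c).bind fun c' => run M c' w

theorem exists_run_of_chain (M : Machine Bool n m) {c d : M.Cfg} {p : List M.Cfg}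
    (hp : p.head? = some c) (hd : p.getLast? = some d) (hc : p.IsChain M.Next) :
    ∃ w, w.length + 1 = p.length ∧ M.run c w = some d := by
  induction p generalizing c with
  | nil => simp at hp
  | cons x p ih =>
    rcases p with _ | ⟨y, p⟩
    · simp at hp hd
      subst hp hd
      exact ⟨[], rfl, rfl⟩
    · simp at hp
      subst hp
      rw [List.isChain_cons_cons] at hc
      rw [List.getLast?_cons_cons] at hd
      obtain ⟨w, h₁, h₂⟩ := ih rfl hd hc.2
      obtain ⟨b, hb⟩ := hc.1
      exact ⟨b :: w, by simpa using h₁, by simp [run, hb, h₂]⟩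

theorem exists_chain_of_run (M : Machine Bool n m) {c d : M.Cfg} {w : Str}
    (h : M.run c w = some d) : ∃ p : List M.Cfg, w.length + 1 = p.length ∧ p.head? = some c ∧
      p.getLast? = some d ∧ p.IsChain M.Next := by
  induction w generalizing c with
  | nil =>
    simp [run] at h
    subst h
    exact ⟨[c], by simp⟩
  | cons b w ih =>
    rw [run, Option.bind_eq_some_iff] at h
    obtain ⟨c', h₁, h₂⟩ := h
    obtain ⟨p, h₃, h₄, h₅, h₆⟩ := ih h₂
    rcases p with _ | ⟨y, p⟩
    · simp at h₃
    · simp at h₄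
      subst h₄
      refine ⟨c :: y :: p, by simpa using h₃, rfl, ?_, ?_⟩
      · rwa [List.getLast?_cons_cons]
      · exact List.isChain_cons_cons.2 ⟨⟨b, h₁⟩, h₆⟩

/-- `w` is the list of choices on an accepting path of `M` on input `x`. -/
def IsWitness (M : Machine Bool 1 0) (w x : Str) : Prop :=
  ∃ c, M.run (M.initial ![x]) w = some c ∧ c.l = none ∧ M.acc c.var = true

theorem accepts_iff_exists_witness (M : Machine Bool 1 0) (x : Str) :
    M.Accepts ![x] ↔ ∃ w, M.IsWitness w x := by
  constructor
  · rintro ⟨p, c, ⟨h₁, h₂⟩, h₃, h₄⟩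
    obtain ⟨w, -, hw⟩ := M.exists_run_of_chain h₁ h₃ h₂
    exact ⟨w, c, hw, h₄⟩
  · rintro ⟨w, c, hw, h₄⟩
    obtain ⟨p, -, h₁, h₃, h₂⟩ := M.exists_chain_of_run hw
    exact ⟨p, c, ⟨h₁, h₂⟩, h₃, h₄⟩

/-- The polynomial that bounds the number of steps also bounds the number of choices. -/
theorem PolyTime.exists_run_bound {M : Machine Bool 1 0} (h : M.PolyTime) :
    ∃ q : Polynomial ℕ, ∀ (x w : Str) (c : M.Cfg), M.run (M.initial ![x]) w = some c →
      w.length ≤ q.eval x.length := by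
  obtain ⟨q, hq⟩ := h
  refine ⟨q, fun x w c hw => ?_⟩
  obtain ⟨p, h₀, h₁, h₃, h₂⟩ := M.exists_chain_of_run hw
  have := hq ![x] p ⟨h₁, h₂⟩
  simp at this
  omega

/-- A deterministic machine, regarded as a nondeterministic one. -/
def toNondet (M : Machine Unit n m) : Machine Bool n m where
  W := M.W
  decW := M.decW
  finW := M.finW
  L := M.L
  finL := M.finL
  S := M.S
  finS := M.finS
  start := M.start
  init := M.init
  acc := M.acc
  prog _ := M.prog ()

theorem toNondet_next (M : Machine Unit n m) :
    M.toNondet.Next = M.Next := by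
  ext c c'
  exact ⟨fun ⟨_, h⟩ => ⟨(), h⟩, fun ⟨_, h⟩ => ⟨true, h⟩⟩

end Machine

/-- Paths are lists of configurations, not of choices. Two identical transition functions therefore
create no additional paths, and determinism leaves at most one path that ends in a halted
configuration. -/
theorem mem_UP_of_inP {A : Language Bool} {M : Machine Unit 1 0} (hM : M.PolyTime)
    (hA : ∀ x, x ∈ A ↔ M.Accepts ![x]) : A ∈ UP := by
  have key : M.toNondet.IsPath = M.IsPath := by
    funext x p
    unfold Machine.IsPath
    rw [Machine.toNondet_next]
    rfl
  refine ⟨M.toNondet, ?_, ?_, ?_⟩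
  · obtain ⟨q, hq⟩ := hM
    exact ⟨q, fun x p hp => hq x p (key ▸ hp)⟩
  · intro x
    rw [hA]
    unfold Machine.Accepts Machine.IsAcceptingPath Machine.IsAcceptingPathTo
    rw [key]
    rfl
  · rintro x p ⟨c, h₁, h₂, h₃, -⟩ p' ⟨c', h₁', h₂', h₃', -⟩
    rw [key] at h₁ h₁'
    have e := M.next_unit
    refine eq_of_chain h₁.1 h₁'.1 (e ▸ h₁.2) (e ▸ h₁'.2) ?_ ?_
    · intro d hd
      obtain rfl : c = d := by simpa [h₂] using hd
      exact step_eq_none.2 h₃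
    · intro d hd
      obtain rfl : c' = d := by simpa [h₂'] using hd
      exact step_eq_none.2 h₃'

theorem UP_subset_NP : UP ⊆ NP := fun _ ⟨M, h₁, h₂, _⟩ => ⟨M, h₁, h₂⟩

/-! ### Embedding statements into larger machines -/

/-- A statement, transported along a map of stacks, a projection `get` of internal states with
section `set`, and a map of labels. Instead of halting, `h` is executed. -/
def liftStmt {K K' L L' S S' : Type} (ι : K → K') (get : S' → S) (set : S' → S → S')
    (fl : L → L') (h : Stmt (fun _ : K' => Bool) L' S') :
    Stmt (fun _ : K => Bool) L S → Stmt (fun _ : K' => Bool) L' S'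
  | .push k f q => .push (ι k) (fun s => f (get s)) (liftStmt ι get set fl h q)
  | .peek k f q => .peek (ι k) (fun s o => set s (f (get s) o)) (liftStmt ι get set fl h q)
  | .pop k f q => .pop (ι k) (fun s o => set s (f (get s) o)) (liftStmt ι get set fl h q)
  | .load a q => .load (fun s => set s (a (get s))) (liftStmt ι get set fl h q)
  | .branch p q q' =>
    .branch (fun s => p (get s)) (liftStmt ι get set fl h q) (liftStmt ι get set fl h q')
  | .goto l => .goto fun s => fl (l (get s))
  | .halt => h

theorem extend_update {K K' α : Type} [DecidableEq K] [DecidableEq K'] {ι : K → K'}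
    (hι : Injective ι) (s : K → α) (T : K' → α) (k : K) (a : α) :
    extend ι (update s k a) T = update (extend ι s T) (ι k) a := by
  funext j
  by_cases hj : ∃ i, ι i = j
  · obtain ⟨i, rfl⟩ := hj
    by_cases hi : i = k
    · subst hi
      simp [hι.extend_apply]
    · simp [hι.extend_apply, hi, hι.eq_iff]
  · have : j ≠ ι k := fun h => hj ⟨k, h.symm⟩
    simp [extend_apply' _ _ _ hj, this]

theorem extend_comp_self {K K' α : Type} {ι : K → K'} (hι : Injective ι) (T : K' → α) :
    extend ι (T ∘ ι) T = T := by
  funext j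
  by_cases hj : ∃ i, ι i = j
  · obtain ⟨i, rfl⟩ := hj
    simp [hι.extend_apply]
  · simp [extend_apply' _ _ _ hj]

/-- The lifted statement reads and writes only the stacks in the image of `ι` and the `get` part of
the state. By `hss` each write replaces the previous one, so the surrounding state stays `u`
throughout. -/
theorem stepAux_liftStmt {K K' L L' S S' : Type} [DecidableEq K] [DecidableEq K'] {ι : K → K'}
    (hι : Injective ι) {get : S' → S} {set : S' → S → S'} (fl : L → L')
    (h : Stmt (fun _ : K' => Bool) L' S') (hgs : ∀ v s, get (set v s) = s)
    (hss : ∀ v s s', set (set v s) s' = set v s') (q : Stmt (fun _ : K => Bool) L S)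
    (u : S') (s : S) (t : K → Str) (T : K' → Str) :
    stepAux (liftStmt ι get set fl h q) (set u s) (extend ι t T) =
      match stepAux q s t with
      | ⟨some l, s', t'⟩ => ⟨some (fl l), set u s', extend ι t' T⟩
      | ⟨none, s', t'⟩ => stepAux h (set u s') (extend ι t' T) := by
  induction q generalizing s t with
  | push k f q ih =>
    simp only [liftStmt, stepAux, hgs, hι.extend_apply]
    rw [← extend_update hι, ih]
  | peek k f q ih => simp only [liftStmt, stepAux, hgs, hss, hι.extend_apply, ih]
  | pop k f q ih =>
    simp only [liftStmt, stepAux, hgs, hss, hι.extend_apply]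
    rw [← extend_update hι, ih]
  | load a q ih => simp only [liftStmt, stepAux, hgs, hss, ih]
  | branch p q q' ih ih' =>
    simp only [liftStmt, stepAux, hgs]
    cases p s
    · exact ih' s t
    · exact ih s t
  | goto l => simp only [liftStmt, stepAux, hgs]
  | halt => simp only [liftStmt, stepAux]

/-! ### Program fragments -/

/-- A deterministic program that works on the stacks `K` and halts accepting or rejecting. -/
structure Frag (K : Type) where
  /-- labels -/
  L : Type
  [finL : Fintype L]
  /-- internal states -/
  S : Type
  [finS : Fintype S]
  /-- label at which the program starts -/
  start : L
  /-- internal state in which the program starts -/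
  init : S
  /-- the accepting states -/
  acc : S → Bool
  /-- the statements -/
  prog : L → Stmt (fun _ : K => Bool) L S

namespace Frag

variable {K : Type} [DecidableEq K]

/-- Started on the stacks `T`, the program halts after `n` steps with the stacks `T'`; it accepts
if `b` is true and rejects if `b` is false. -/
def Run (F : Frag K) (T : K → Str) (n : ℕ) (b : Bool) (T' : K → Str) : Prop :=
  ∃ v, StepsIn (TM2.step F.prog) n ⟨some F.start, F.init, T⟩ ⟨none, v, T'⟩ ∧ F.acc v = b

/-- The continuation `h` is executed inside the very step in which the original program halts. The
step count is thus unchanged, and lengths add exactly under `cond` and `seq`. -/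
theorem stepsIn_lift {K' L L' S S' : Type} [DecidableEq K'] {ι : K → K'}
    (hι : Injective ι) {get : S' → S} {set : S' → S → S'} (fl : L → L')
    (h : Stmt (fun _ : K' => Bool) L' S') (hgs : ∀ v s, get (set v s) = s)
    (hss : ∀ v s s', set (set v s) s' = set v s')
    {P : L → Stmt (fun _ : K => Bool) L S} {P' : L' → Stmt (fun _ : K' => Bool) L' S'}
    (hP : ∀ l, P' (fl l) = liftStmt ι get set fl h (P l))
    {n : ℕ} {l : L} {s s' : S} {t t' : K → Str} (u : S') (T : K' → Str)
    {d : Cfg (fun _ : K' => Bool) L' S'} (hd : stepAux h (set u s') (extend ι t' T) = d)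
    (hr : StepsIn (TM2.step P) n ⟨some l, s, t⟩ ⟨none, s', t'⟩) :
    StepsIn (TM2.step P') n ⟨some (fl l), set u s, extend ι t T⟩ d := by
  generalize hc : (⟨some l, s, t⟩ : Cfg (fun _ : K => Bool) L S) = c at hr
  generalize he : (⟨none, s', t'⟩ : Cfg (fun _ : K => Bool) L S) = e at hr
  induction hr generalizing l s t with
  | refl a =>
    subst hc
    simp at he
  | @head a b e n h₁ h₂ ih =>
    subst hc he
    rw [TM2.step, Option.some.injEq] at h₁
    have key := stepAux_liftStmt hι fl h hgs hss (P l) u s t T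
    rw [h₁] at key
    rcases b with ⟨_ | l₁, s₁, t₁⟩
    · rcases h₂ with _ | ⟨h₃, -⟩
      · refine .head ?_ (.refl _)
        rw [TM2.step, hP, key]
        exact congrArg some hd
      · simp at h₃
    · refine .head ?_ (ih rfl rfl)
      rw [TM2.step, hP, key]

/-- Run `F₁`; if it accepts, run `F₂` next, and if it rejects, run `F₃` next. -/
def cond (F₁ F₂ F₃ : Frag K) : Frag K where
  L := F₁.L ⊕ F₂.L ⊕ F₃.L
  finL := letI := F₁.finL; letI := F₂.finL; letI := F₃.finL; inferInstance
  S := F₁.S × F₂.S × F₃.S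
  finS := letI := F₁.finS; letI := F₂.finS; letI := F₃.finS; inferInstance
  start := .inl F₁.start
  init := (F₁.init, F₂.init, F₃.init)
  acc v := if F₁.acc v.1 then F₂.acc v.2.1 else F₃.acc v.2.2
  prog
    | .inl l => liftStmt id (fun v => v.1) (fun v s => (s, v.2.1, v.2.2)) Sum.inl
        (.goto fun v => if F₁.acc v.1 then .inr (.inl F₂.start) else .inr (.inr F₃.start))
        (F₁.prog l)
    | .inr (.inl l) => liftStmt id (fun v => v.2.1) (fun v s => (v.1, s, v.2.2))
        (fun l => Sum.inr (Sum.inl l)) .halt (F₂.prog l)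
    | .inr (.inr l) => liftStmt id (fun v => v.2.2) (fun v s => (v.1, v.2.1, s))
        (fun l => Sum.inr (Sum.inr l)) .halt (F₃.prog l)

theorem Run.cond_of_true {F₁ F₂ F₃ : Frag K} {T T₁ T₂ : K → Str} {n₁ n₂ : ℕ} {b : Bool}
    (h₁ : F₁.Run T n₁ true T₁) (h₂ : F₂.Run T₁ n₂ b T₂) :
    (F₁.cond F₂ F₃).Run T (n₁ + n₂) b T₂ := by
  obtain ⟨v₁, h₁, e₁⟩ := h₁
  obtain ⟨v₂, h₂, e₂⟩ := h₂
  refine ⟨(v₁, v₂, F₃.init), ?_, by simp [cond, e₁, e₂]⟩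
  have a₁ := stepsIn_lift (P' := (F₁.cond F₂ F₃).prog)
    (set := fun v s => (s, v.2.1, v.2.2)) injective_id Sum.inl _ (fun _ _ => rfl)
    (fun _ _ _ => rfl) (fun _ => rfl) (F₁.init, F₂.init, F₃.init) T rfl h₁
  have a₂ := stepsIn_lift (P' := (F₁.cond F₂ F₃).prog)
    (set := fun v s => (v.1, s, v.2.2)) injective_id (fun l => Sum.inr (Sum.inl l)) _ (fun _ _ => rfl)
    (fun _ _ _ => rfl) (fun _ => rfl) (v₁, F₂.init, F₃.init) T rfl h₂
  simp only [extend_id, stepAux, e₁, if_true] at a₁ a₂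
  exact a₁.trans a₂

theorem Run.cond_of_false {F₁ F₂ F₃ : Frag K} {T T₁ T₂ : K → Str} {n₁ n₂ : ℕ} {b : Bool}
    (h₁ : F₁.Run T n₁ false T₁) (h₂ : F₃.Run T₁ n₂ b T₂) :
    (F₁.cond F₂ F₃).Run T (n₁ + n₂) b T₂ := by
  obtain ⟨v₁, h₁, e₁⟩ := h₁
  obtain ⟨v₂, h₂, e₂⟩ := h₂
  refine ⟨(v₁, F₂.init, v₂), ?_, by simp [cond, e₁, e₂]⟩
  have a₁ := stepsIn_lift (P' := (F₁.cond F₂ F₃).prog)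
    (set := fun v s => (s, v.2.1, v.2.2)) injective_id Sum.inl _ (fun _ _ => rfl)
    (fun _ _ _ => rfl) (fun _ => rfl) (F₁.init, F₂.init, F₃.init) T rfl h₁
  have a₂ := stepsIn_lift (P' := (F₁.cond F₂ F₃).prog)
    (set := fun v s => (v.1, v.2.1, s)) injective_id (fun l => Sum.inr (Sum.inr l)) _ (fun _ _ => rfl)
    (fun _ _ _ => rfl) (fun _ => rfl) (v₁, F₂.init, F₃.init) T rfl h₂
  simp only [extend_id, stepAux, e₁, Bool.false_eq_true, if_false] at a₁ a₂
  exact a₁.trans a₂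

/-- Run `F`, then `G`. -/
def seq (F G : Frag K) : Frag K := F.cond G G

theorem Run.seq {F G : Frag K} {T T₁ T₂ : K → Str} {n₁ n₂ : ℕ} {b₁ b : Bool}
    (h₁ : F.Run T n₁ b₁ T₁) (h₂ : G.Run T₁ n₂ b T₂) : (F.seq G).Run T (n₁ + n₂) b T₂ := by
  cases b₁
  · exact h₁.cond_of_false h₂
  · exact h₁.cond_of_true h₂

/-- A fragment, working on part of a larger set of stacks. -/
def embed {K' : Type} (ι : K → K') (F : Frag K) : Frag K' where
  L := F.L
  finL := F.finL
  S := F.S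
  finS := F.finS
  start := F.start
  init := F.init
  acc := F.acc
  prog l := liftStmt ι id (fun _ s => s) id .halt (F.prog l)

theorem Run.embed {K' : Type} [DecidableEq K'] {ι : K → K'} (hι : Injective ι) {F : Frag K}
    {T : K' → Str} {t' : K → Str} {n : ℕ} {b : Bool} (h : F.Run (T ∘ ι) n b t') :
    (F.embed ι).Run T n b (extend ι t' T) := by
  obtain ⟨v, h, e⟩ := h
  have a := stepsIn_lift (P' := (F.embed ι).prog) (set := fun _ s => s) hι id _ (fun _ _ => rfl)
    (fun _ _ _ => rfl) (fun _ => rfl) F.init T rfl h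
  rw [extend_comp_self hι] at a
  exact ⟨v, a, e⟩

/-! ### Elementary fragments -/

/-- Push the letter `b` on the stack `k`. -/
def push (k : K) (b : Bool) : Frag K where
  L := Unit
  S := Unit
  start := ()
  init := ()
  acc _ := true
  prog _ := .push k (fun _ => b) .halt

theorem run_push (k : K) (b : Bool) (T : K → Str) :
    (push k b).Run T 1 true (update T k (b :: T k)) :=
  ⟨(), .head rfl (.refl _), rfl⟩

/-- Remove the top letter of the stack `k`. -/
def pop (k : K) : Frag K where
  L := Unit
  S := Unit
  start := ()
  init := ()
  acc _ := true
  prog _ := .pop k (fun _ _ => ()) .halt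

theorem run_pop (k : K) (T : K → Str) : (pop k).Run T 1 true (update T k (T k).tail) :=
  ⟨(), .head rfl (.refl _), rfl⟩

/-- Accept if the top letters of the stacks `k` and `k'` satisfy `p`. -/
def test (k k' : K) (p : Option Bool → Option Bool → Bool) : Frag K where
  L := Unit
  S := Option Bool × Option Bool
  start := ()
  init := (none, none)
  acc v := p v.1 v.2
  prog _ := .peek k (fun v o => (o, v.2)) (.peek k' (fun v o => (v.1, o)) .halt)

theorem run_test (k k' : K) (p : Option Bool → Option Bool → Bool) (T : K → Str) :
    (test k k' p).Run T 1 (p (T k).head? (T k').head?) T :=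
  ⟨((T k).head?, (T k').head?), .head rfl (.refl _), rfl⟩

/-- Pop the letters of the stack `k` until it is empty, and push each of them on `j` and `j'`. -/
def pour (k j j' : K) : Frag K where
  L := Unit
  S := Option Bool
  start := ()
  init := none
  acc _ := true
  prog _ := .pop k (fun _ o => o) (.branch Option.isSome
    (.push j (fun v => v.getD false) (.push j' (fun v => v.getD false) (.goto fun _ => ()))) .halt)

theorem run_pour {k j j' : K} (hj : k ≠ j) (hj' : k ≠ j') (h : j ≠ j') (T : K → Str) :
    (pour k j j').Run T ((T k).length + 1) true
      (update (update (update T k []) j ((T k).reverse ++ T j)) j' ((T k).reverse ++ T j')) := by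
  -- The loop is re-entered with the last popped letter as its state, so the induction needs an
  -- arbitrary state `v`. The extra step is the pop that finds the stack empty.
  suffices H : ∀ (x : Str) (v : Option Bool) (T : K → Str), T k = x →
      StepsIn (TM2.step (pour k j j').prog) (x.length + 1) ⟨some (), v, T⟩
        ⟨none, none, update (update (update T k []) j (x.reverse ++ T j)) j' (x.reverse ++ T j')⟩ from
    ⟨none, H _ _ T rfl, rfl⟩
  intro x
  induction x with
  | nil =>
    intro v T hT
    refine .head ?_ (.refl _)
    simp only [pour, TM2.step, stepAux, hT, List.head?_nil, Option.isSome_none, cond_false,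
      List.tail_nil, List.reverse_nil, List.nil_append, Option.some.injEq, Cfg.mk.injEq, true_and]
    funext i
    by_cases h₁ : i = j' <;> by_cases h₂ : i = j <;> simp [h₁, h₂, update_apply, h, hj.symm, hj'.symm]
  | cons b x ih =>
    intro v T hT
    have := ih (some b) (update (update (update T k x) j (b :: T j)) j' (b :: T j'))
      (by simp [hj, hj'])
    refine .head (b := ⟨some (), some b, _⟩) ?_ (by
      rw [List.length_cons]
      convert this using 2
      funext i
      by_cases h₁ : i = j' <;> by_cases h₂ : i = j <;> by_cases h₃ : i = k <;>
        simp [h₁, h₂, h₃, update_apply, h])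
    simp [pour, hT, h.symm, hj.symm, hj'.symm]

/-! ### Checking a witness deterministically -/

/-- Simulate the nondeterministic machine `M` on the stacks `ι k`, taking its choices from the
stack `c`; accept if `M` accepts when the choices are used up. -/
def simulate {n m : ℕ} (M : Machine Bool n m) (ι : M.Stk → K) (c : K) : Frag K where
  L := M.L
  finL := M.finL
  S := M.S × Option Bool × Bool
  finS := letI := M.finS; inferInstance
  start := M.start
  init := (M.init, none, false)
  acc v := v.2.2
  prog l :=
    letI q (b : Bool) : Stmt (fun _ : K => Bool) M.L (M.S × Option Bool × Bool) :=
      liftStmt ι Prod.fst (fun v s => (s, v.2)) id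
        (.pop c (fun v o => (v.1, v.2.1, M.acc v.1 && o.isNone)) .halt) (M.prog b l)
    .pop c (fun v o => (v.1, o, v.2.2))
      (.branch (fun v => v.2.1 = some true) (q true)
        (.branch (fun v => v.2.1 = some false) (q false) .halt))

/-- The simulation follows a genuine run of `M`, of choices `w'`, and stops when `M` halts or the
choices run out. Its length is thus controlled by the running time of `M`, however long the supplied
`w` is. The last clause protects data kept on the other stacks. -/
theorem stepsIn_simulate {n m : ℕ} (M : Machine Bool n m) {ι : M.Stk → K} (hι : Injective ι)
    {c : K} (hc : ∀ k, ι k ≠ c) (w : Str) (l : M.L) (s : M.S) (o : Option Bool) (T : K → Str)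
    (hT : T c = w) :
    ∃ n v T', StepsIn (TM2.step (simulate M ι c).prog) n ⟨some l, (s, o, false), T⟩ ⟨none, v, T'⟩ ∧
      (v.2.2 = true ↔ ∃ d, M.run ⟨some l, s, T ∘ ι⟩ w = some d ∧ d.l = none ∧ M.acc d.var = true) ∧
      (∃ w' d, M.run ⟨some l, s, T ∘ ι⟩ w' = some d ∧ n ≤ w'.length + 1) ∧
      ∀ k, (∀ i, ι i ≠ k) → k ≠ c → T' k = T k := by
  induction w generalizing l s o T with
  | nil =>
    refine ⟨1, (s, none, false), T, .head ?_ (.refl _), ?_, ⟨[], _, rfl, by simp⟩, fun _ _ _ => rfl⟩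
    · have : update T c [] = T := by rw [← hT, update_eq_self]
      simp [simulate, hT, this]
    · simp [Machine.run]
  | cons b w ih =>
    have hT₁ : update T c w ∘ ι = T ∘ ι := by
      funext k
      simp [hc k]
    have hstep : TM2.step (simulate M ι c).prog ⟨some l, (s, o, false), T⟩ =
        some (stepAux (liftStmt ι Prod.fst (fun v s => (s, v.2)) id
          (.pop c (fun v o => (v.1, v.2.1, M.acc v.1 && o.isNone)) .halt) (M.prog b l))
          (s, some b, false) (update T c w)) := by
      cases b <;> simp [simulate, hT]
    have key := stepAux_liftStmt hι (id : M.L → M.L) (get := Prod.fst)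
      (set := fun (v : M.S × Option Bool × Bool) s => (s, v.2))
      (.pop c (fun v o => (v.1, v.2.1, M.acc v.1 && o.isNone)) .halt) (fun _ _ => rfl)
      (fun _ _ _ => rfl) (M.prog b l) (s, some b, false) s (T ∘ ι) (update T c w)
    -- The current stacks are the extension of their own restriction along `ι`, which brings them
    -- into the form needed for lifting.
    rw [← hT₁, extend_comp_self hι, hT₁] at key
    have hrun : ∀ u, M.run ⟨some l, s, T ∘ ι⟩ (b :: u) =
        M.run (stepAux (M.prog b l) s (T ∘ ι)) u := fun u => by simp [Machine.run]
    simp only [hrun]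
    rcases hd : stepAux (M.prog b l) s (T ∘ ι) with ⟨_ | l', s', t'⟩
    · rw [hd] at key
      have hcT : extend ι t' (update T c w) c = w := by
        rw [extend_apply' _ _ _ (by rintro ⟨k, hk⟩; exact hc k hk)]
        simp
      refine ⟨1, _, _, .head (hstep.trans (congrArg some key)) (.refl _), ?_,
        ⟨[b], _, by rw [hrun, hd]; rfl, by simp⟩, ?_⟩
      -- `M` has halted: the remaining choices `w` must be empty, since a halted machine has no run
      -- along further choices.
      · simp only [hcT]
        cases w <;> simp [Machine.run]
      · intro k hk hkc
        simp only [update_of_ne hkc]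
        rw [extend_apply' _ _ _ (by rintro ⟨i, hi⟩; exact hk i hi), update_of_ne hkc]
    · rw [hd] at key
      have hcT : extend ι t' (update T c w) c = w := by
        rw [extend_apply' _ _ _ (by rintro ⟨k, hk⟩; exact hc k hk)]
        simp
      obtain ⟨n, v, T', h₁, h₂, ⟨w', d, h₃, h₄⟩, h₅⟩ := ih l' s' (some b) _ hcT
      rw [extend_comp hι] at h₂ h₃
      refine ⟨n + 1, v, T', .head (hstep.trans (congrArg some key)) h₁, h₂,
        ⟨b :: w', d, by rw [hrun, hd, h₃], by simpa using h₄⟩, ?_⟩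
      intro k hk hkc
      rw [h₅ k hk hkc, extend_apply' _ _ _ (by rintro ⟨i, hi⟩; exact hk i hi), update_of_ne hkc]

theorem run_simulate (M : Machine Bool 1 0) {ι : M.Stk → K} (hι : Injective ι)
    {c : K} (hc : ∀ k, ι k ≠ c) {x : Str} {T : K → Str} (hT : T ∘ ι = (M.initial ![x]).stk) :
    ∃ n b T', (simulate M ι c).Run T n b T' ∧ (b = true ↔ M.IsWitness (T c) x) ∧
      (∃ w d, M.run (M.initial ![x]) w = some d ∧ n ≤ w.length + 1) ∧
      ∀ k, (∀ i, ι i ≠ k) → k ≠ c → T' k = T k := by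
  obtain ⟨n, v, T', h₁, h₂, h₃, h₄⟩ := stepsIn_simulate M hι hc (T c) M.start M.init none T rfl
  rw [hT] at h₂ h₃
  exact ⟨n, v.2.2, T', ⟨v, h₁, rfl⟩, h₂, h₃, h₄⟩

/-- Reverse the stack `x` onto the input stack of `M`, push also on the stack `z`, and simulate
`M` with the choices on the stack `c`. -/
def verify (M : Machine Bool 1 0) (ι : M.Stk → K) (x z c : K) : Frag K :=
  (pour x (ι (.inl 0)) z).seq (simulate M ι c)

/-- Pouring undoes the reversal on `r`, so `M` receives `x` itself. The stack `z` is merely the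
second target that `pour` demands. Pouring costs |x| + 1 steps and the simulation at most |w| + 1.
-/
theorem run_verify (M : Machine Bool 1 0) {ι : M.Stk → K} (hι : Injective ι) {r z c : K}
    (hr : ∀ k, ι k ≠ r) (hz : ∀ k, ι k ≠ z) (hc : ∀ k, ι k ≠ c) (hrz : r ≠ z) (hrc : r ≠ c)
    (hzc : z ≠ c) {x : Str} {T : K → Str} (hTr : T r = x.reverse) (hT : ∀ k, T (ι k) = []) :
    ∃ n b T', (verify M ι r z c).Run T n b T' ∧ (b = true ↔ M.IsWitness (T c) x) ∧
      (∃ w d, M.run (M.initial ![x]) w = some d ∧ n ≤ x.length + w.length + 2) ∧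
      ∀ k, (∀ i, ι i ≠ k) → k ≠ c → k ≠ r → k ≠ z → T' k = T k := by
  have h₁ := run_pour (hr (.inl 0)).symm hrz (hz (.inl 0)) T
  rw [hT, hTr, List.reverse_reverse, List.append_nil, List.length_reverse] at h₁
  obtain ⟨n, b, T', h₂, h₃, ⟨w, d, h₄, h₅⟩, h₆⟩ := run_simulate M hι hc (x := x)
    (T := update (update (update T r []) (ι (.inl 0)) x) z (x ++ T z)) (by
      funext k
      simp only [comp_apply, update_of_ne (hz k)]
      by_cases hk : k = .inl 0
      · subst hk
        simp [Machine.initial]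
      · rw [update_of_ne (hι.ne hk), update_of_ne (hr k), hT]
        rcases k with k | k
        · exact absurd (congrArg Sum.inl (Subsingleton.elim k 0)) hk
        · rfl)
  refine ⟨_, b, T', h₁.seq h₂, ?_, ⟨w, d, h₄, by omega⟩, ?_⟩
  · rw [h₃, update_of_ne hzc.symm, update_of_ne (hc _).symm, update_of_ne hrc.symm]
  · intro k hk hkc hkr hkz
    rw [h₆ k hk hkc, update_of_ne hkz, update_of_ne (hk _).symm, update_of_ne hkr]

/-! ### Passing between fragments and machines -/

/-- A fragment, regarded as a machine. -/
def toMachine {n m : ℕ} {W : Type} [DecidableEq W] [Fintype W] (F : Frag (Fin n ⊕ Fin m ⊕ W)) :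
    Machine Unit n m where
  W := W
  L := F.L
  finL := F.finL
  S := F.S
  finS := F.finS
  start := F.start
  init := F.init
  acc := F.acc
  prog _ := F.prog

/-- A deterministic machine, regarded as a fragment. -/
def ofMachine {n m : ℕ} (M : Machine Unit n m) : Frag M.Stk where
  L := M.L
  finL := M.finL
  S := M.S
  finS := M.finS
  start := M.start
  init := M.init
  acc := M.acc
  prog := M.prog ()

theorem polyTime_toMachine {n m : ℕ} {W : Type} [DecidableEq W] [Fintype W]
    {F : Frag (Fin n ⊕ Fin m ⊕ W)} {q : Polynomial ℕ}
    (h : ∀ x : Fin n → Str, ∃ k b T', F.Run (Sum.elim x fun _ => []) k b T' ∧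
      k ≤ q.eval (∑ i, (x i).length)) : F.toMachine.PolyTime := by
  refine ⟨q, fun x p hp => ?_⟩
  obtain ⟨k, b, T', ⟨v, h₁, -⟩, h₂⟩ := h x
  have h₃ := hp.2
  rw [Machine.next_unit] at h₃
  exact (StepsIn.chain h₁ rfl hp.1 h₃).1.trans (by omega)

/-- By determinism every path ending in a halted configuration ends where the run does. The
condition on the final stacks is kept abstract to cover both acceptance and output. -/
theorem acceptingPathTo_toMachine {n m : ℕ} {W : Type} [DecidableEq W] [Fintype W]
    {F : Frag (Fin n ⊕ Fin m ⊕ W)} {x : Fin n → Str} {k : ℕ} {b : Bool}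
    {T' : Fin n ⊕ Fin m ⊕ W → Str} (h : F.Run (Sum.elim x fun _ => []) k b T')
    (P : F.toMachine.Cfg → Prop) (Q : (Fin n ⊕ Fin m ⊕ W → Str) → Prop) (hPQ : ∀ c, P c ↔ Q c.stk) :
    (∃ p c, F.toMachine.IsAcceptingPathTo x p c ∧ P c) ↔ b = true ∧ Q T' := by
  obtain ⟨v, h₁, h₂⟩ := h
  constructor
  · rintro ⟨p, c, ⟨⟨h₃, h₄⟩, h₅, h₆, h₇⟩, h₈⟩
    rw [Machine.next_unit] at h₄
    obtain rfl := (StepsIn.chain h₁ rfl h₃ h₄).2 c h₅ (step_eq_none.2 h₆)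
    exact ⟨h₂ ▸ h₇, (hPQ _).1 h₈⟩
  · rintro ⟨rfl, h₈⟩
    obtain ⟨p, -, h₃, h₄, h₅⟩ := h₁.exists_chain
    refine ⟨p, ⟨none, v, T'⟩, ⟨⟨h₃, ?_⟩, h₄, rfl, h₂⟩, (hPQ _).2 h₈⟩
    rw [Machine.next_unit]
    exact h₅

theorem accepts_toMachine {n m : ℕ} {W : Type} [DecidableEq W] [Fintype W]
    {F : Frag (Fin n ⊕ Fin m ⊕ W)} {x : Fin n → Str} {k : ℕ} {b : Bool}
    {T' : Fin n ⊕ Fin m ⊕ W → Str} (h : F.Run (Sum.elim x fun _ => []) k b T') :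
    F.toMachine.Accepts x ↔ b = true := by
  simpa [Machine.Accepts, Machine.IsAcceptingPath] using
    acceptingPathTo_toMachine h (fun _ => True) (fun _ => True) fun _ => Iff.rfl

theorem outputs_toMachine {n m : ℕ} {W : Type} [DecidableEq W] [Fintype W]
    {F : Frag (Fin n ⊕ Fin m ⊕ W)} {x : Fin n → Str} {k : ℕ} {b : Bool}
    {T' : Fin n ⊕ Fin m ⊕ W → Str} (h : F.Run (Sum.elim x fun _ => []) k b T')
    (y : Fin m → Str) :
    F.toMachine.Outputs x y ↔ b = true ∧ ∀ j, T' (.inr (.inl j)) = y j :=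
  acceptingPathTo_toMachine h (fun c => ∀ j, c.stk (.inr (.inl j)) = y j)
    (fun T => ∀ j, T (.inr (.inl j)) = y j) fun _ => Iff.rfl

theorem run_ofMachine {n m : ℕ} {M : Machine Unit n m} {q : Polynomial ℕ}
    (hq : ∀ (x : Fin n → Str) (p : List M.Cfg), M.IsPath x p →
      p.length ≤ q.eval (∑ i, (x i).length) + 1)
    {x : Fin n → Str} {y : Fin m → Str} (h : M.Outputs x y) :
    ∃ k T', (ofMachine M).Run (Sum.elim x fun _ => []) k true T' ∧
      k ≤ q.eval (∑ i, (x i).length) ∧ ∀ j, T' (.inr (.inl j)) = y j := by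
  obtain ⟨p, ⟨l, v, T'⟩, ⟨⟨h₁, h₂⟩, h₃, h₄, h₅⟩, h₆⟩ := h
  have h₇ := hq x p ⟨h₁, h₂⟩
  rw [Machine.next_unit] at h₂
  have h₄ : l = none := h₄
  subst h₄
  exact ⟨p.length - 1, T', ⟨v, .of_chain h₁ h₃ h₂, h₅⟩, by omega, h₆⟩

end Frag

/-! ### The one-way function -/

open Classical in
/-- The function that maps `(1w, 0x)` to the reversal of `x`, prefixed with `0`, if `w` is a witness
for `x`. It is also defined, with empty value, on the pair of empty strings and on all pairs of
strings that start with `1`. -/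
noncomputable def witnessFun (M : Machine Bool 1 0) : BinFun
  | [], [] => some []
  | true :: _, true :: _ => some []
  | true :: w, false :: x => if M.IsWitness w x then some (false :: x.reverse) else none
  | _, _ => none

theorem witnessFun_eq_some {M : Machine Bool 1 0} {a b z : Str} :
    witnessFun M a b = some z ↔ (a = [] ∧ b = [] ∧ z = []) ∨
      (∃ s t, a = true :: s ∧ b = true :: t ∧ z = []) ∨
      ∃ w x, a = true :: w ∧ b = false :: x ∧ z = false :: x.reverse ∧ M.IsWitness w x := by
  rcases a with _ | ⟨_ | _, w⟩ <;> rcases b with _ | ⟨_ | _, x⟩ <;>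
    simp [witnessFun, eq_comm, and_comm]

instance {C : Type} {n m : ℕ} (M : Machine C n m) : Fintype M.W := M.finW

theorem polynomial_eval_mono (p : Polynomial ℕ) {a b : ℕ} (h : a ≤ b) : p.eval a ≤ p.eval b := by
  simp only [Polynomial.eval_eq_sum, Polynomial.sum]
  gcongr

set_option synthInstance.maxSize 1000

/-! ### Evaluating the function, and deciding the language from an inverter -/

namespace Frag

/-- The stacks of the fragment that computes `witnessFun M`. -/
abbrev EvalStk (M : Machine Bool 1 0) : Type := Fin 2 ⊕ Fin 1 ⊕ Bool ⊕ M.Stk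

/-- A fragment that computes `witnessFun M`. -/
def eval (M : Machine Bool 1 0) : Frag (EvalStk M) :=
  (test (.inl 0) (.inl 1) fun o o' => o = some true && o' = some false).cond
    ((pop (.inl 0)).seq ((pop (.inl 1)).seq
      ((pour (.inl 1) (.inr (.inr (.inl false))) (.inr (.inl 0))).seq
        ((push (.inr (.inl 0)) false).seq
          (verify M (fun k => .inr (.inr (.inr k))) (.inr (.inr (.inl false)))
            (.inr (.inr (.inl true))) (.inl 0))))))
    (test (.inl 0) (.inl 1) fun o o' => (o = some true || o = none) && o' = o)

theorem run_eval {M : Machine Bool 1 0} {q : Polynomial ℕ}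
    (hq : ∀ (x w : Str) (c : M.Cfg), M.run (M.initial ![x]) w = some c →
      w.length ≤ q.eval x.length) (x : Fin 2 → Str) :
    ∃ n b T', (eval M).Run (Sum.elim x fun _ => []) n b T' ∧
      n ≤ (2 * Polynomial.X + q + 10 : Polynomial ℕ).eval (∑ i, (x i).length) ∧
      ∀ z, witnessFun M (x 0) (x 1) = some z ↔ b = true ∧ T' (.inr (.inl 0)) = z := by
  set T : EvalStk M → Str := Sum.elim x fun _ => [] with hT
  have h₁ := run_test (.inl 0) (.inl 1) (fun o o' => o = some true && o' = some false) T
  simp only [hT, Sum.elim_inl] at h₁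
  rw [← hT] at h₁
  simp only [Fin.sum_univ_two]
  by_cases hx : (x 0).head? = some true ∧ (x 1).head? = some false
  · obtain ⟨w, hw⟩ : ∃ w, x 0 = true :: w := by
      rcases h : x 0 with _ | ⟨b, w⟩ <;> simp_all
    obtain ⟨y, hy⟩ : ∃ y, x 1 = false :: y := by
      rcases h : x 1 with _ | ⟨b, w⟩ <;> simp_all
    simp only [hx, decide_true, Bool.and_self] at h₁
    have t₁ : T (.inl 0) = true :: w := by rw [← hw]; rfl
    have t₂ : T (.inl 1) = false :: y := by rw [← hy]; rfl
    have t₃ : ∀ k, T (.inr k) = [] := fun k => rfl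
    have h₂ := run_pop (.inl 0) T
    have h₃ := run_pop (.inl 1) (update T (.inl 0) (T (.inl 0)).tail)
    obtain ⟨T₂, hT₂⟩ : ∃ T₂, T₂ = update (update T (.inl 0) (T (.inl 0)).tail) (.inl 1)
      (update T (.inl 0) (T (.inl 0)).tail (.inl 1)).tail := ⟨_, rfl⟩
    rw [← hT₂] at h₃
    -- One pour leaves the reversed string both on a work stack, for the later check, and on the
    -- output stack. This is why the function reverses `x`.
    have h₄ := run_pour (k := .inl 1) (j := .inr (.inr (.inl false))) (j' := .inr (.inl 0))
      (by simp) (by simp) (by simp) T₂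
    have e₁ : T₂ (.inl 1) = y := by
      simp only [hT₂, t₂, update_of_ne, update_self, ne_eq, Sum.inl.injEq, Fin.reduceEq, not_false_eq_true,
        List.tail_cons]
    have e₂ : T₂ (.inl 0) = w := by
      simp only [hT₂, t₁, update_of_ne, update_self, ne_eq, Sum.inl.injEq, Fin.reduceEq, not_false_eq_true,
        List.tail_cons]
    have e₃ : ∀ k, T₂ (.inr k) = [] := by
      intro k
      simp only [hT₂, t₃, update_of_ne, ne_eq, reduceCtorEq, not_false_eq_true]
    rw [e₁, e₃, e₃, List.append_nil] at h₄
    have h₅ := run_push (.inr (.inl 0)) false (update (update (update T₂ (.inl 1) [])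
      (.inr (.inr (.inl false))) y.reverse) (.inr (.inl 0)) y.reverse)
    rw [update_self, update_idem] at h₅
    obtain ⟨n, b, T', h₆, h₇, ⟨w', d, h₈, h₉⟩, h₀⟩ := run_verify M
      (ι := fun k => .inr (.inr (.inr k))) (r := .inr (.inr (.inl false)))
      (z := .inr (.inr (.inl true))) (c := .inl 0) (x := y)
      (T := update (update (update T₂ (.inl 1) [])
        (.inr (.inr (.inl false))) y.reverse) (.inr (.inl 0)) (false :: y.reverse))
      (fun a b h => by simpa using h)
      (by simp) (by simp) (by simp) (by simp) (by simp) (by simp) (by simp)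
      (fun k => by simp [e₃])
    refine ⟨_, b, T', h₁.cond_of_true (h₂.seq (h₃.seq (h₄.seq (h₅.seq h₆)))), ?_, ?_⟩
    -- The total is at most 2|y| + |w'| + 7 steps, where `w'` is the choice sequence of a run on
    -- `y`, so |w'| ≤ q(|y|).
    · have h := hq y w' d h₈
      have hm : q.eval y.length ≤ q.eval ((x 0).length + (x 1).length) :=
        polynomial_eval_mono _ (by simp only [hy, List.length_cons]; omega)
      simp only [Polynomial.eval_add, Polynomial.eval_mul, Polynomial.eval_ofNat,
        Polynomial.eval_X]
      simp only [hw, hy, List.length_cons] at hm ⊢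
      omega
    · intro z
      have h := h₀ (.inr (.inl 0)) (by simp) (by simp) (by simp) (by simp)
      simp only [e₂, update_of_ne, update_self, ne_eq, reduceCtorEq, Sum.inl.injEq, Fin.reduceEq,
        not_false_eq_true] at h₇ h
      rw [h, h₇, hw, hy, witnessFun_eq_some]
      simp [eq_comm, and_comm]
  -- Outside the witness case the function is defined exactly when both top letters are 1 or both
  -- strings are empty. Its value is then ε, which the untouched output stack already holds.
  · have h₂ := run_test (.inl 0) (.inl 1)
      (fun o o' => (o = some true || o = none) && o' = o) T
    simp only [hT, Sum.elim_inl] at h₂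
    rw [← hT] at h₂
    have hb : (decide ((x 0).head? = some true) && decide ((x 1).head? = some false)) = false := by
      simpa using hx
    rw [hb] at h₁
    refine ⟨_, _, T, h₁.cond_of_false h₂, by simp, ?_⟩
    intro z
    rw [witnessFun_eq_some, show T (.inr (.inl 0)) = [] from rfl, @eq_comm _ [] z]
    clear * - hx
    generalize x 0 = a at hx ⊢
    generalize x 1 = b at hx ⊢
    rcases a with _ | ⟨_ | _, w⟩ <;> rcases b with _ | ⟨_ | _, y⟩ <;> simp at hx ⊢

/-- The stacks of the fragment that decides the language of `M` by means of the inverter `G`. -/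
abbrev DecideStk (M : Machine Bool 1 0) (G : Machine Unit 1 2) : Type :=
  Fin 1 ⊕ Fin 0 ⊕ Bool ⊕ M.Stk ⊕ G.Stk

/-- A fragment that decides the language of `M` by means of an inverter `G` of `witnessFun M`. -/
def decider (M : Machine Bool 1 0) (G : Machine Unit 1 2) : Frag (DecideStk M G) :=
  (pour (.inl 0) (.inr (.inr (.inl false))) (.inr (.inr (.inr (.inr (.inl 0)))))).seq
    ((push (.inr (.inr (.inr (.inr (.inl 0))))) false).seq
      (((ofMachine G).embed fun k => .inr (.inr (.inr (.inr k)))).seq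
        ((pop (.inr (.inr (.inr (.inr (.inr (.inl 0))))))).seq
          (verify M (fun k => .inr (.inr (.inr (.inl k)))) (.inr (.inr (.inl false)))
            (.inr (.inr (.inl true))) (.inr (.inr (.inr (.inr (.inr (.inl 0))))))))))

/-- The inverter's first answer, stripped of its leading letter, is only a candidate witness and is
always checked, so nothing is assumed about `y` beyond its being the output. The inverter's input
has length |x| + 1, hence the composition with `X + 1`. -/
theorem run_decider {M : Machine Bool 1 0} {q : Polynomial ℕ}
    (hq : ∀ (x w : Str) (c : M.Cfg), M.run (M.initial ![x]) w = some c →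
      w.length ≤ q.eval x.length) {G : Machine Unit 1 2} {q' : Polynomial ℕ}
    (hq' : ∀ (x : Fin 1 → Str) (p : List G.Cfg), G.IsPath x p →
      p.length ≤ q'.eval (∑ i, (x i).length) + 1)
    (x : Str) {y : Fin 2 → Str} (hy : G.Outputs ![false :: x.reverse] y) :
    ∃ n b T', (decider M G).Run (Sum.elim ![x] fun _ => []) n b T' ∧
      n ≤ (2 * Polynomial.X + q + q'.comp (Polynomial.X + 1) + 10 : Polynomial ℕ).eval x.length ∧
      (b = true ↔ M.IsWitness (y 0).tail x) := by
  set T : DecideStk M G → Str := Sum.elim ![x] fun _ => [] with hT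
  have h₁ := run_pour (k := .inl 0) (j := .inr (.inr (.inl false)))
    (j' := .inr (.inr (.inr (.inr (.inl 0))))) (by simp) (by simp) (by simp) T
  have e₁ : T (.inl 0) = x := by simp [hT]
  have e₂ : ∀ k, T (.inr k) = [] := by simp [hT]
  rw [e₁, e₂, e₂, List.append_nil] at h₁
  have h₂ := run_push (.inr (.inr (.inr (.inr (.inl 0))))) false (update (update
    (update T (.inl 0) []) (.inr (.inr (.inl false))) x.reverse)
      (.inr (.inr (.inr (.inr (.inl 0))))) x.reverse)
  rw [update_self, update_idem] at h₂
  set T₁ := update (update (update T (.inl 0) []) (.inr (.inr (.inl false))) x.reverse)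
      (.inr (.inr (.inr (.inr (.inl 0))))) (false :: x.reverse) with hT₁
  obtain ⟨k, t, h₃, h₄, h₅⟩ := run_ofMachine hq' hy
  set ιG : G.Stk → DecideStk M G := fun k => .inr (.inr (.inr (.inr k))) with hιG
  have inj : Injective ιG := fun a b h => by simpa [hιG] using h
  have e₃ : T₁ ∘ ιG = Sum.elim ![false :: x.reverse] fun _ => [] := by
    funext k
    rcases k with k | k
    · obtain rfl := Subsingleton.elim k 0
      simp [hT₁, hιG]
    · simp [hT₁, hιG, e₂]
  rw [← e₃] at h₃
  have h₆ := Run.embed inj h₃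
  have h₇ := run_pop (ιG (.inr (.inl 0))) (extend ιG t T₁)
  rw [inj.extend_apply, h₅] at h₇
  -- The inverter leaves all stacks but its own alone: the saved copy of `x` survives and the stacks
  -- of `M` are still empty.
  have e₄ : ∀ k, (∀ i, ιG i ≠ k) → update (extend ιG t T₁) (ιG (.inr (.inl 0))) (y 0).tail k =
      T₁ k := by
    intro k hk
    rw [update_of_ne (hk _).symm, extend_apply' _ _ _ (by rintro ⟨i, hi⟩; exact hk i hi)]
  obtain ⟨n, b, T', h₈, h₉, ⟨w', d, h₁₀, h₁₁⟩, -⟩ := run_verify M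
    (ι := fun k => .inr (.inr (.inr (.inl k)))) (r := .inr (.inr (.inl false)))
    (z := .inr (.inr (.inl true))) (c := ιG (.inr (.inl 0))) (x := x)
    (T := update (extend ιG t T₁) (ιG (.inr (.inl 0))) (y 0).tail)
    (fun a b h => by simpa using h) (by simp) (by simp) (by simp [hιG]) (by simp)
    (by simp [hιG]) (by simp [hιG])
    (by rw [e₄ _ (by simp [hιG])]; simp [hT₁])
    (fun k => by rw [e₄ _ (by simp [hιG])]; simp [hT₁, e₂])
  refine ⟨_, b, T', h₁.seq (h₂.seq (h₆.seq (h₇.seq h₈))), ?_, ?_⟩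
  · have h := hq x w' d h₁₀
    simp at h₄
    simp only [Polynomial.eval_add, Polynomial.eval_mul, Polynomial.eval_ofNat,
      Polynomial.eval_X, Polynomial.eval_comp, Polynomial.eval_one]
    omega
  · rw [h₉, update_self]

end Frag

/-! ### Properties of the one-way function -/

theorem witnessFun_honest {M : Machine Bool 1 0} {q : Polynomial ℕ}
    (hq : ∀ (x w : Str) (c : M.Cfg), M.run (M.initial ![x]) w = some c →
      w.length ≤ q.eval x.length) : (witnessFun M).Honest := by
  refine ⟨Polynomial.X + q + 1, ?_⟩
  rintro z ⟨a, b, h⟩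
  rcases witnessFun_eq_some.1 h with ⟨-, -, rfl⟩ | ⟨-, -, -, -, rfl⟩ | ⟨w, x, rfl, rfl, rfl, hw⟩
  -- The given preimage of ε may be arbitrarily long; the pair (ε, ε) replaces it.
  · exact ⟨[], [], rfl, by simp⟩
  · exact ⟨[], [], rfl, by simp⟩
  · refine ⟨_, _, h, ?_⟩
    obtain ⟨c, hc, -⟩ := hw
    have h₁ := hq x w c hc
    have h₂ : q.eval x.length ≤ q.eval (x.length + 1) := polynomial_eval_mono _ (by omega)
    simp
    omega

/-- For `xy` to be a legal first argument it must be ε, as it cannot start with 1. This forces `z`,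
then `y`, then `x` to be ε. -/
theorem witnessFun_weaklyAssociative (M : Machine Bool 1 0) :
    (witnessFun M).WeaklyAssociative := by
  intro x y z xy yz l r h₁ h₂ h₃ h₄
  rw [witnessFun_eq_some] at h₁ h₂ h₃ h₄
  rcases h₁ with ⟨rfl, rfl, rfl⟩ | ⟨s, t, rfl, rfl, rfl⟩ | ⟨w, x, rfl, rfl, rfl, -⟩ <;>
    simp_all

theorem witnessFun_polyTimeComputable {M : Machine Bool 1 0} (hM : M.PolyTime) :
    PolyTimeComputable (fun v : Fin 2 → Str => (witnessFun M (v 0) (v 1)).map fun z => ![z]) := by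
  obtain ⟨q, hq⟩ := hM.exists_run_bound
  refine ⟨(Frag.eval M).toMachine, Frag.polyTime_toMachine (F := Frag.eval M)
    (q := 2 * Polynomial.X + q + 10) fun x => ?_, fun x y => ?_⟩
  · obtain ⟨n, b, T', h, hn, -⟩ := Frag.run_eval hq x
    exact ⟨n, b, T', h, hn⟩
  · obtain ⟨n, b, T', h, -, hz⟩ := Frag.run_eval hq x
    rw [Frag.outputs_toMachine h, Fin.forall_fin_one, ← hz, Option.map_eq_some_iff]
    constructor
    · rintro ⟨z, h₁, rfl⟩
      exact h₁
    · intro h₁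
      exact ⟨_, h₁, by funext j; rw [Subsingleton.elim j 0]; rfl⟩

theorem witnessFun_domain_inP {M : Machine Bool 1 0} (hM : M.PolyTime) :
    InP (witnessFun M).domain := by
  obtain ⟨q, hq⟩ := hM.exists_run_bound
  -- A decision machine has no outputs, so the output stack of the evaluator becomes a work stack.
  let ι : Frag.EvalStk M → Fin 2 ⊕ Fin 0 ⊕ Fin 1 ⊕ Bool ⊕ M.Stk := Sum.map id Sum.inr
  have hι : Injective ι := injective_id.sumMap Sum.inr_injective
  have key : ∀ x : Fin 2 → Str, ∃ n b T', ((Frag.eval M).embed ι).Run (Sum.elim x fun _ => []) n b T' ∧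
      n ≤ (2 * Polynomial.X + q + 10 : Polynomial ℕ).eval (∑ i, (x i).length) ∧
      (x ∈ (witnessFun M).domain ↔ b = true) := by
    intro x
    obtain ⟨n, b, T', h, hn, hz⟩ := Frag.run_eval hq x
    refine ⟨n, b, _, Frag.Run.embed hι (t' := T') ?_, hn, ?_⟩
    · convert h using 1
      funext k
      rcases k with k | k <;> rfl
    · simp [BinFun.domain, hz]
  refine ⟨((Frag.eval M).embed ι).toMachine, Frag.polyTime_toMachine
    (q := 2 * Polynomial.X + q + 10) fun x => ?_, fun x => ?_⟩
  · obtain ⟨n, b, T', h, hn, -⟩ := key x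
    exact ⟨n, b, T', h, hn⟩
  · obtain ⟨n, b, T', h, -, hx⟩ := key x
    rw [Frag.accepts_toMachine h, hx]

/-- If x lies in A, then 0 followed by x reversed is in the range, and its only preimages are pairs
(1w, 0x) with w a witness. If x is not in A, no candidate passes the check. -/
theorem mem_UP_of_fpInvertible {M : Machine Bool 1 0} (hM : M.PolyTime) {A : Language Bool}
    (hA : ∀ x, x ∈ A ↔ M.Accepts ![x]) (h : (witnessFun M).FPInvertible) : A ∈ UP := by
  obtain ⟨q, hq⟩ := hM.exists_run_bound
  obtain ⟨g, ⟨G, ⟨q', hq'⟩, hG⟩, hg⟩ := h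
  have key : ∀ x : Str, ∃ n b T', (Frag.decider M G).Run (Sum.elim ![x] fun _ => []) n b T' ∧
      n ≤ (2 * Polynomial.X + q + q'.comp (Polynomial.X + 1) + 10 : Polynomial ℕ).eval x.length ∧
      (b = true ↔ x ∈ A) := by
    intro x
    obtain ⟨n, b, T', h₁, h₂, h₃⟩ := Frag.run_decider hq hq' x ((hG _ _).1 rfl)
    refine ⟨n, b, T', h₁, h₂, ?_⟩
    rw [h₃, hA, M.accepts_iff_exists_witness]
    refine ⟨fun h => ⟨_, h⟩, fun ⟨w, hw⟩ => ?_⟩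
    have h₄ := hg (false :: x.reverse)
      ⟨true :: w, false :: x, witnessFun_eq_some.2 (.inr (.inr ⟨w, x, rfl, rfl, rfl, hw⟩))⟩
    rw [witnessFun_eq_some] at h₄
    rcases h₄ with ⟨-, -, h⟩ | ⟨-, -, -, -, h⟩ | ⟨w', x', h₅, -, h₆, h₇⟩
    · simp at h
    · simp at h
    · simp at h₆
      subst h₆
      simpa [h₅] using h₇
  have e : ∀ x : Fin 1 → Str, x = ![x 0] := fun x => by
    funext i
    rw [Subsingleton.elim i 0]
    rfl
  refine mem_UP_of_inP (M := (Frag.decider M G).toMachine) (Frag.polyTime_toMachine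
    (q := 2 * Polynomial.X + q + q'.comp (Polynomial.X + 1) + 10) fun x => ?_) fun x => ?_
  · obtain ⟨n, b, T', h₁, h₂, -⟩ := key (x 0)
    rw [e x]
    exact ⟨n, b, T', h₁, by simpa using h₂⟩
  · obtain ⟨n, b, T', h₁, -, h₃⟩ := key x
    rw [Frag.accepts_toMachine h₁, h₃]

/-- Associativity with respect to complete equality implies weak associativity. -/
theorem BinFun.Associative.weaklyAssociative {σ : BinFun} (h : σ.Associative) :
    σ.WeaklyAssociative := by
  intro x y z xy yz l r h₁ h₂ h₃ h₄
  have := h x y z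
  simp only [hat, h₁, h₂, h₃, h₄, Option.some.injEq] at this
  exact this.symm

theorem not_weaklyAssociative_totalExtension (M : Machine Bool 1 0) {a : Str}
    (ha : ![a, a] ∉ (witnessFun M).domain) :
    ¬ ((witnessFun M).totalExtension a).WeaklyAssociative := by
  intro h
  -- The triple (1, 1, ε): the product 1 ∘ ε is undefined and becomes `a`, while 1 ∘ 1 = ε. The
  -- value of 1 ∘ a stays open, depending on whether ε is a witness.
  have h₁ := h [true] [true] [] [] a ((witnessFun M [true] a).getD a) [] rfl rfl rfl rfl
  rcases a with _ | ⟨_ | _, x⟩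
  · exact ha ⟨[], rfl⟩
  -- Only a = 0x is possible. Whether or not ε is a witness for x, 1 ∘ a starts with 0 and so
  -- differs from ε ∘ ε = ε.
  · simp only [witnessFun] at h₁
    split_ifs at h₁ <;> simp at h₁
  · exact ha ⟨[], rfl⟩

end OneWay

theorem mainTheorem3 (h : OneWay.UP ≠ OneWay.NP) :
    ∃ σ : OneWay.BinFun,
      σ.IsAwOWF ∧
      OneWay.InP σ.domain ∧
      (∃ a : OneWay.Str, ![a, a] ∉ σ.domain) ∧
      ∀ a : OneWay.Str, ![a, a] ∉ σ.domain →
        ¬ (σ.totalExtension a).Associative ∧ ¬ (σ.totalExtension a).WeaklyAssociative := by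
  obtain ⟨A, ⟨M, hM, hA⟩, hUP⟩ : ∃ A ∈ OneWay.NP, A ∉ OneWay.UP := by
    by_contra! hc
    exact h (OneWay.UP_subset_NP.antisymm hc)
  obtain ⟨q, hq⟩ := hM.exists_run_bound
  refine ⟨OneWay.witnessFun M, ⟨OneWay.witnessFun_weaklyAssociative M,
    OneWay.witnessFun_honest hq, OneWay.witnessFun_polyTimeComputable hM,
    fun hinv => hUP (OneWay.mem_UP_of_fpInvertible hM hA hinv)⟩,
    OneWay.witnessFun_domain_inP hM, ⟨[false], ?_⟩, fun a ha => ?_⟩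
  · rintro ⟨z, hz⟩
    simp [OneWay.witnessFun] at hz
  · have hw := OneWay.not_weaklyAssociative_totalExtension M ha
    exact ⟨fun hass => hw hass.weaklyAssociative, hw⟩
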